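/- Let $E$ and $F$ be finite directed graphs (loops and parallel edges allowed) that are essential, i.e. have no sources and no sinks, and let $A_E$, $A_F$ be their adjacency matrices, where $A_E(v,w)$ is the number of edges from $v$ to $w$. Suppose that $A_E$ and $A_F$ are shift equivalent: there are an integer $\ell\ge 1$ and matrices $R,S$ with nonnegative integer entries such that $A_E^{\ell}=RS$, $A_F^{\ell}=SR$, $A_ER=RA_F$ and $SA_E=A_FS$. A path $e_1\cdots e_n$ with $n\ge 1$ is a cycle based at $v$ if it starts and ends at $v$ and the sources of $e_1,\dots,e_n$ are distinct. A graph has disjoint cycles if each of its vertices is the base of at most one cycle. Let $\mathcal C_E$ be the set of cycles of $E$, where cycles that differ only in the choice of the base vertex (cyclic rotation of the edges) are identified. For $c,c'\in\mathcal C_E$ write $c\le c'$ if there is a path (possibly of length $0$) from a vertex on $c'$ to a vertex on $c$, and let $|c|$ be the length of $c$. The relation $\le$ is a preorder, and a partial order if $E$ has disjoint cycles. Then $E$ has disjoint cycles if and only if $F$ has disjoint cycles. In this case there is an isomorphism of partially ordered sets $\phi\colon\mathcal C_E\to\mathcal C_F$ (a bijection with $c\le c'\iff\phi(c)\le\phi(c')$)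 such that $|\phi(c)|=|c|$ for all $c\in\mathcal C_E$. -/

import Mathlib

/-! A directed graph with vertex type `V` is a `Quiver V` (parallel edges and loops allowed); an
edge from `v` to `w` is an element of `v ⟶ w`, and a path is a `Quiver.Path`, vertices being the
paths of length zero. -/

namespace GraphCycles

universe u v

section Matrices

/-- Shift equivalence of square matrices over the nonnegative integers. -/
def ShiftEquivalent {m n : Type*} [Fintype m] [DecidableEq m] [Fintype n] [DecidableEq n]
    (A : Matrix m m ℕ) (B : Matrix n n ℕ) : Prop :=
  ∃ l : ℕ, 1 ≤ l ∧ ∃ (R : Matrix m n ℕ) (S : Matrix n m ℕ),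
    A ^ l = R * S ∧ B ^ l = S * R ∧ A * R = R * B ∧ S * A = B * S

/-- The adjacency matrix: the entry at `(v, w)` is the number of edges from `v` to `w`. -/
def adjMatrix (V : Type u) [Quiver.{v} V] [∀ a b : V, Fintype (a ⟶ b)] : Matrix V V ℕ :=
  Matrix.of fun a b => Fintype.card (a ⟶ b)

end Matrices

/-- The graph has no sinks and no sources. -/
def IsEssential (V : Type u) [Quiver.{v} V] : Prop :=
  (∀ a : V, ∃ b : V, Nonempty (a ⟶ b)) ∧ (∀ b : V, ∃ a : V, Nonempty (a ⟶ b))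

section Cycles

variable {V : Type u} [Quiver.{v} V]

/-- The string of edges `e₁ ⋯ eₙ` of a path; `Quiver.Total V` is the type of all edges. -/
def edgeList {a : V} : ∀ {b : V}, Quiver.Path a b → List (Quiver.Total V)
  | _, Quiver.Path.nil => []
  | _, Quiver.Path.cons p e => edgeList p ++ [⟨_, _, e⟩]

/-- A closed path of positive length is a cycle if the sources of its edges are distinct. -/
def IsCyclePath {a : V} (p : Quiver.Path a a) : Prop :=
  0 < p.length ∧ ((edgeList p).map Quiver.Total.left).Nodup

variable (V) in
/-- Every vertex is the base of at most one cycle. -/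
def HasDisjointCycles : Prop :=
  ∀ (a : V) (p q : Quiver.Path a a), IsCyclePath p → IsCyclePath q → p = q

variable (V) in
/-- A cycle together with the vertex at which it is based. -/
structure BasedCycle where
  base : V
  path : Quiver.Path base base
  isCycle : IsCyclePath path

/-- Based cycles are identified when their strings of edges are rotations of each other, that is,
when they are the same cycle read from different base vertices. -/
instance basedCycleSetoid : Setoid (BasedCycle V) :=
  (List.IsRotated.setoid (Quiver.Total V)).comap fun c => edgeList c.path

variable (V) in
/-- The set of distinct cycles of the graph. -/
def CycleSet : Type (max u v) := Quotient (basedCycleSetoid (V := V))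

theorem length_edgeList {a b : V} (p : Quiver.Path a b) : (edgeList p).length = p.length := by
  induction p with
  | nil => rfl
  | cons p e ih => simp [edgeList, ih]

theorem path_of_mem_edgeList {a b : V} (p : Quiver.Path a b) (e : Quiver.Total V)
    (he : e ∈ edgeList p) :
    Nonempty (Quiver.Path a e.left) ∧ Nonempty (Quiver.Path e.right b) := by
  induction p with
  | nil => simp [edgeList] at he
  | cons p f ih =>
    simp only [edgeList, List.mem_append, List.mem_singleton] at he
    rcases he with he | rfl
    · obtain ⟨h₁, ⟨h₂⟩⟩ := ih he
      exact ⟨h₁, ⟨h₂.cons f⟩⟩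
    · exact ⟨⟨p⟩, ⟨Quiver.Path.nil⟩⟩

/-- The length of a cycle. -/
def CycleSet.length : CycleSet V → ℕ :=
  Quotient.lift (fun c : BasedCycle V => c.path.length) fun c d h => by
    rw [← length_edgeList, ← length_edgeList]
    exact List.Perm.length_eq (List.IsRotated.perm h)

/-- The set of vertices lying on a cycle: the sources and the ranges of its edges. -/
def CycleSet.support : CycleSet V → Set V :=
  Quotient.lift
    (fun c : BasedCycle V => {w | ∃ e ∈ edgeList c.path, w = e.left ∨ w = e.right})
    fun c d h => by
      ext w
      have key : ∀ e, e ∈ edgeList c.path ↔ e ∈ edgeList d.path :=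
        fun e => List.IsRotated.mem_iff h
      simp only [Set.mem_ofPred_eq, key]

theorem CycleSet.support_nonempty (c : CycleSet V) : c.support.Nonempty := by
  induction c using Quotient.inductionOn with
  | h c =>
    have h : 0 < (edgeList c.path).length := by
      rw [length_edgeList]; exact c.isCycle.1
    obtain ⟨e, he⟩ := List.exists_mem_of_length_pos h
    exact ⟨e.left, e, he, Or.inl rfl⟩

theorem CycleSet.path_of_mem_support (c : CycleSet V) {x y : V} (hx : x ∈ c.support)
    (hy : y ∈ c.support) : Nonempty (Quiver.Path x y) := by
  induction c using Quotient.inductionOn with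
  | h c =>
    have key : ∀ z, (∃ e ∈ edgeList c.path, z = e.left ∨ z = e.right) →
        Nonempty (Quiver.Path c.base z) ∧ Nonempty (Quiver.Path z c.base) := by
      rintro z ⟨e, he, hz⟩
      obtain ⟨⟨p⟩, ⟨q⟩⟩ := path_of_mem_edgeList c.path e he
      rcases hz with rfl | rfl
      · exact ⟨⟨p⟩, ⟨e.hom.toPath.comp q⟩⟩
      · exact ⟨⟨p.cons e.hom⟩, ⟨q⟩⟩
    obtain ⟨-, ⟨p⟩⟩ := key x hx
    obtain ⟨⟨q⟩, -⟩ := key y hy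
    exact ⟨p.comp q⟩

/-- The preorder on cycles: `c ≤ c'` if some path starts at a vertex on `c'` and ends at a vertex
on `c`. -/
instance : Preorder (CycleSet V) where
  le c c' := ∃ w ∈ c.support, ∃ w' ∈ c'.support, Nonempty (Quiver.Path w' w)
  le_refl c := by
    obtain ⟨w, hw⟩ := c.support_nonempty
    exact ⟨w, hw, w, hw, ⟨Quiver.Path.nil⟩⟩
  le_trans := by
    rintro c d e ⟨w, hw, x, hx, ⟨p⟩⟩ ⟨y, hy, z, hz, ⟨q⟩⟩
    obtain ⟨r⟩ := d.path_of_mem_support hy hx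
    exact ⟨w, hw, z, hz, ⟨(q.comp r).comp p⟩⟩

end Cycles

end GraphCycles

/-!
Let `(R, S)` be a shift equivalence of lag `l` between the adjacency matrices `A` and `B`. A graph
has disjoint cycles iff a closed path is determined by its base and its length, that is, iff all
diagonal entries of all powers of `A` are at most `1`. Otherwise some diagonal entry of the powers
grows exponentially, whereas `tr (A ^ N) = tr (R * B ^ (N - l) * S) = tr (B ^ N)` is at most the
number of vertices of the other graph if that one has disjoint cycles.

For the isomorphism, regard `R` and `S` as edges between the two graphs and match two cycles if
their base vertices can be reached from each other. Passing along `R` and `S` transports paths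
between matched vertices, changing all lengths by the same constant; hence the matching respects
`≤`, and it preserves `|c|`, which divides the length of every closed path based on `c`.
-/

namespace GraphCycles

universe u v u' v'

theorem isRotated_of_append_eq_append {α : Type*} {l l' m : List α} (h : l ++ m = m ++ l') :
    l ~r l' := by
  rcases eq_or_ne l [] with rfl | hl
  · obtain rfl : l' = [] := by simpa using h
    rfl
  obtain ⟨n, hm, hm'⟩ | ⟨n, rfl, rfl⟩ := List.append_eq_append_iff.1 h
  · have : n.length < m.length := by simpa [hm] using List.length_pos_of_ne_nil hl
    exact isRotated_of_append_eq_append (hm.symm.trans hm')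
  · exact List.isRotated_append
termination_by m.length

theorem exists_orderIso_of_rel {α β : Type*} [PartialOrder α] [PartialOrder β] {r : α → β → Prop}
    (hα : ∀ a, ∃ b, r a b) (hβ : ∀ b, ∃ a, r a b)
    (hle : ∀ {a a' b b'}, r a b → r a' b' → (a ≤ a' ↔ b ≤ b')) :
    ∃ φ : α ≃o β, ∀ a, r a (φ a) := by
  choose f hf using hα
  have hsurj : Function.Surjective f := fun b => by
    obtain ⟨a, ha⟩ := hβ b
    exact ⟨a, le_antisymm ((hle (hf a) ha).1 le_rfl) ((hle ha (hf a)).1 le_rfl)⟩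
  let e := OrderEmbedding.ofMapLEIff f fun a a' => (hle (hf a) (hf a')).symm
  exact ⟨RelIso.ofSurjective e hsurj, hf⟩

section Paths

open Quiver

variable {V : Type u} [Quiver.{v} V] {a b c d : V}

theorem vertices_prefix_vertices_comp (p : Path a b) (q : Path b c) :
    p.vertices <+: (p.comp q).vertices := by
  induction q with
  | nil => exact List.prefix_rfl
  | cons q e ih => simpa using ih.trans (List.prefix_append _ _)

theorem exists_nodup_vertices (p : Path a b) : ∃ q : Path a b, q.vertices.Nodup := by
  induction p with
  | nil => exact ⟨Path.nil, by simp⟩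
  | @cons _ c _ e ih =>
    obtain ⟨q, hq⟩ := ih
    by_cases hc : c ∈ q.vertices
    · obtain ⟨q₁, q₂, rfl⟩ := q.exists_eq_comp_of_mem_vertices hc
      exact ⟨q₁, (vertices_prefix_vertices_comp q₁ q₂).sublist.nodup hq⟩
    · exact ⟨q.cons e, by simpa using (List.nodup_concat _ _).2 ⟨hc, hq⟩⟩

theorem sigma_eq_of_comp_eq_comp {p : Path a b} {q : Path b d} {p' : Path a c} {q' : Path c d}
    (h : p.comp q = p'.comp q') (hq : q.length = q'.length) :
    (⟨b, q⟩ : Σ x, Path x d) = ⟨c, q'⟩ := by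
  induction q with
  | nil =>
    cases q' with
    | nil => rfl
    | cons q' f => simp at hq
  | cons q e ih =>
    cases q' with
    | nil => simp at hq
    | cons q' f =>
      simp only [Path.comp_cons, Path.cons.injEq] at h
      obtain ⟨rfl, h, he⟩ := h
      cases he
      cases ih (eq_of_heq h) (by simpa using hq)
      rfl

theorem exists_eq_comp_of_comp_comm {p q : Path a a} (h : p.comp q = q.comp p)
    (hle : p.length ≤ q.length) : ∃ r : Path a a, q = r.comp p := by
  obtain ⟨b, r, p', rfl, hr⟩ := q.exists_eq_comp_of_le_length (Nat.sub_le q.length p.length)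
  rw [← Path.comp_assoc] at h
  have hp' : p'.length = p.length := by
    rw [Path.length_comp] at hr hle
    omega
  cases sigma_eq_of_comp_eq_comp h hp'
  exact ⟨r, rfl⟩

theorem map_left_edgeList (p : Path a b) :
    (edgeList p).map Total.left = p.vertices.dropLast := by
  induction p with
  | nil => rfl
  | cons p e ih => simp [edgeList, ih]

theorem edgeList_comp (p : Path a b) (q : Path b c) :
    edgeList (p.comp q) = edgeList p ++ edgeList q := by
  induction q with
  | nil => simp [edgeList]
  | cons q e ih => simp [edgeList, ih]

end Paths

section CyclePaths

open Quiver

variable {V : Type u} [Quiver.{v} V] {a b c : V}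

theorem isCyclePath_cons_iff {p : Path b a} {e : a ⟶ b} :
    IsCyclePath (p.cons e) ↔ p.vertices.Nodup := by
  simp [IsCyclePath, map_left_edgeList]

theorem exists_isCyclePath_cons (p : Path b a) (e : a ⟶ b) :
    ∃ q : Path b a, IsCyclePath (q.cons e) := by
  simpa only [isCyclePath_cons_iff] using exists_nodup_vertices p

theorem exists_isCyclePath {p : Path a a} (hp : 0 < p.length) :
    ∃ q : Path a a, IsCyclePath q := by
  obtain ⟨b, p, e, rfl⟩ := (Path.length_ne_zero_iff_eq_cons p).1 hp.ne'
  obtain ⟨q, hq⟩ := exists_isCyclePath_cons p e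
  exact ⟨_, hq⟩

theorem IsCyclePath.length_eq_zero_of_comp {p q : Path a a} (h : IsCyclePath (p.comp q))
    (hq : 0 < q.length) : p.length = 0 := by
  by_contra hp
  obtain ⟨b, p, e, rfl⟩ := (Path.length_ne_zero_iff_eq_cons p).1 hp
  obtain ⟨c, q, f, rfl⟩ := (Path.length_ne_zero_iff_eq_cons q).1 hq.ne'
  have hnodup : (p.vertices ++ q.vertices).Nodup := by
    simpa using isCyclePath_cons_iff.1 h
  exact List.disjoint_of_nodup_append hnodup p.start_mem_vertices q.start_mem_vertices

theorem IsCyclePath.length_le_of_comp_comm {p q : Path a a} (hq : IsCyclePath q)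
    (hp : 0 < p.length) (h : p.comp q = q.comp p) : q.length ≤ p.length := by
  by_contra! hlt
  obtain ⟨r, rfl⟩ := exists_eq_comp_of_comp_comm h hlt.le
  have hr := hq.length_eq_zero_of_comp hp
  rw [Path.length_comp] at hlt
  omega

end CyclePaths

namespace HasDisjointCycles

open Quiver

variable {V : Type u} [Quiver.{v} V] {a b c : V}

theorem sigma_hom_eq (hV : HasDisjointCycles V) (e : a ⟶ c) (f : b ⟶ c)
    (p : Path c a) (q : Path c b) : (⟨a, e⟩ : Σ x, x ⟶ c) = ⟨b, f⟩ := by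
  obtain ⟨p', hp⟩ := exists_isCyclePath_cons p e
  obtain ⟨q', hq⟩ := exists_isCyclePath_cons q f
  cases hV c _ _ hp hq
  rfl

/-- Walking backwards from `c` inside its strongly connected component, there is never a choice. -/
theorem sigma_path_eq (hV : HasDisjointCycles V) (p : Path a c) (q : Path b c)
    (h : p.length = q.length) (r : Path c a) (s : Path c b) :
    (⟨a, p⟩ : Σ x, Path x c) = ⟨b, q⟩ := by
  induction p with
  | nil =>
    cases q with
    | nil => rfl
    | cons q f => simp at h
  | cons p e ih =>
    cases q with
    | nil => simp at h
    | cons q f =>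
      cases hV.sigma_hom_eq e f (r.comp p) (s.comp q)
      cases ih q (by simpa using h) (e.toPath.comp r) (e.toPath.comp s)
      rfl

theorem path_eq (hV : HasDisjointCycles V) {p q : Path a b} (h : p.length = q.length)
    (r : Path b a) : p = q := by
  cases hV.sigma_path_eq p q h r r
  rfl

theorem closedPath_eq (hV : HasDisjointCycles V) {p q : Path a a} (h : p.length = q.length) :
    p = q :=
  hV.path_eq h Path.nil

theorem comp_comm (hV : HasDisjointCycles V) (p q : Path a a) : p.comp q = q.comp p :=
  hV.closedPath_eq (by simp [add_comm])

theorem length_dvd_of_closedPath (hV : HasDisjointCycles V) {c : Path a a} (hc : IsCyclePath c)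
    (p : Path a a) : c.length ∣ p.length := by
  rcases Nat.eq_zero_or_pos p.length with hp | hp
  · exact hp ▸ dvd_zero _
  obtain ⟨q, rfl⟩ := exists_eq_comp_of_comp_comm (hV.comp_comm c p)
    (hc.length_le_of_comp_comm hp (hV.comp_comm p c))
  have : q.length < (q.comp c).length := by simpa using hc.1
  rw [Path.length_comp]
  exact dvd_add (hV.length_dvd_of_closedPath hc q) dvd_rfl
termination_by p.length

theorem length_dvd (hV : HasDisjointCycles V) {c : Path a a} (hc : IsCyclePath c)
    (p : Path a b) (q : Path b a) (d : Path b b) : c.length ∣ d.length := by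
  have h₁ := hV.length_dvd_of_closedPath hc (p.comp q)
  have h₂ := hV.length_dvd_of_closedPath hc ((p.comp d).comp q)
  simp only [Path.length_comp] at h₁ h₂
  rwa [add_right_comm, Nat.dvd_add_right h₁] at h₂

theorem isRotated (hV : HasDisjointCycles V) {c : Path a a} {d : Path b b} (hc : IsCyclePath c)
    (hd : IsCyclePath d) (p : Path a b) (q : Path b a) : edgeList c ~r edgeList d := by
  have hlen : c.length = d.length :=
    Nat.dvd_antisymm (hV.length_dvd hc p q d) (hV.length_dvd hd q p c)
  have hconj : c.comp p = p.comp d := hV.path_eq (by simp [hlen, add_comm]) q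
  apply isRotated_of_append_eq_append (m := edgeList p)
  rw [← edgeList_comp, hconj, edgeList_comp]

end HasDisjointCycles

theorem hasDisjointCycles_iff_closedPath_eq {V : Type u} [Quiver.{v} V] :
    HasDisjointCycles V ↔
      ∀ (a : V) (p q : Quiver.Path a a), p.length = q.length → p = q := by
  refine ⟨fun hV a p q => hV.closedPath_eq, fun h a p q hp hq => h a p q ?_⟩
  have hcomm : p.comp q = q.comp p := h a _ _ (by simp [add_comm])
  exact le_antisymm (hp.length_le_of_comp_comm hq.1 hcomm.symm)
    (hq.length_le_of_comp_comm hp.1 hcomm)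

section CycleOrder

open Quiver

variable {V : Type u} [Quiver.{v} V]

/-- The cycle without its base. -/
def BasedCycle.toCycleSet (γ : BasedCycle V) : CycleSet V := Quotient.mk _ γ

theorem BasedCycle.base_mem_support (γ : BasedCycle V) :
    γ.base ∈ γ.toCycleSet.support := by
  obtain ⟨a, p, hp⟩ := γ
  obtain ⟨b, p, e, rfl⟩ := (Path.length_ne_zero_iff_eq_cons p).1 hp.1.ne'
  exact ⟨⟨b, a, e⟩, by simp [edgeList], Or.inr rfl⟩

theorem BasedCycle.toCycleSet_le_iff {γ δ : BasedCycle V} :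
    γ.toCycleSet ≤ δ.toCycleSet ↔ Nonempty (Path δ.base γ.base) := by
  refine ⟨?_, fun h => ⟨_, γ.base_mem_support, _, δ.base_mem_support, h⟩⟩
  rintro ⟨x, hx, y, hy, ⟨p⟩⟩
  obtain ⟨q⟩ := CycleSet.path_of_mem_support _ δ.base_mem_support hy
  obtain ⟨r⟩ := CycleSet.path_of_mem_support _ hx γ.base_mem_support
  exact ⟨(q.comp p).comp r⟩

/-- The preorder on cycles is antisymmetric if the graph has disjoint cycles: a path `p` from `γ`
to `δ` then satisfies `γ p = p δ`, so `δ` is a rotation of `γ`. -/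
abbrev HasDisjointCycles.partialOrder (hV : HasDisjointCycles V) : PartialOrder (CycleSet V) where
  le_antisymm c d := by
    refine Quotient.inductionOn₂ c d fun γ δ hγδ hδγ => Quotient.sound ?_
    obtain ⟨p⟩ := BasedCycle.toCycleSet_le_iff.1 hγδ
    obtain ⟨q⟩ := BasedCycle.toCycleSet_le_iff.1 hδγ
    exact hV.isRotated γ.isCycle δ.isCycle q p

end CycleOrder

section Counting

open Quiver

variable {V : Type u} [Quiver.{v} V]

/-- Removing the last edge of a path. -/
def pathSuccEquiv (a b : V) (k : ℕ) :
    {p : Path a b // p.length = k + 1} ≃ Σ c : V, {p : Path a c // p.length = k} × (c ⟶ b) where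
  toFun
    | ⟨Path.cons p e, h⟩ => ⟨_, ⟨p, Nat.succ.inj h⟩, e⟩
  invFun x := ⟨x.2.1.1.cons x.2.2, by simp [x.2.1.2]⟩
  left_inv := by
    rintro ⟨_ | ⟨p, e⟩, h⟩
    · simp at h
    · rfl
  right_inv := by
    rintro ⟨c, ⟨p, h⟩, e⟩
    rfl

instance subsingleton_path_length_zero (a b : V) :
    Subsingleton {p : Path a b // p.length = 0} where
  allEq := by
    rintro ⟨p, hp⟩ ⟨q, hq⟩
    obtain rfl := p.eq_of_length_zero hp
    rw [Subtype.mk.injEq, p.eq_nil_of_length_zero hp, q.eq_nil_of_length_zero hq]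

instance finite_path_length [Finite V] [∀ a b : V, Finite (a ⟶ b)] (a b : V) (k : ℕ) :
    Finite {p : Path a b // p.length = k} := by
  induction k generalizing b with
  | zero => infer_instance
  | succ k ih => exact Finite.of_equiv _ (pathSuccEquiv a b k).symm

variable [Fintype V] [DecidableEq V] [∀ a b : V, Fintype (a ⟶ b)]

theorem adjMatrix_pow_apply (a b : V) (k : ℕ) :
    (adjMatrix V ^ k) a b = Nat.card {p : Path a b // p.length = k} := by
  induction k generalizing b with
  | zero =>
    rw [pow_zero, Matrix.one_apply]
    split_ifs with h
    · subst h
      have : Nonempty {p : Path a a // p.length = 0} := ⟨⟨Path.nil, rfl⟩⟩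
      exact Nat.card_unique.symm
    · have : IsEmpty {p : Path a b // p.length = 0} := ⟨fun p => h (p.1.eq_of_length_zero p.2)⟩
      exact Nat.card_of_isEmpty.symm
  | succ k ih =>
    rw [Nat.card_congr (pathSuccEquiv a b k), Nat.card_sigma, pow_succ, Matrix.mul_apply]
    simp only [Nat.card_prod, ← ih, Nat.card_eq_fintype_card]
    rfl

theorem adjMatrix_pow_pos_iff {a b : V} {k : ℕ} :
    0 < (adjMatrix V ^ k) a b ↔ ∃ p : Path a b, p.length = k := by
  rw [adjMatrix_pow_apply, Finite.card_pos_iff, nonempty_subtype]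

theorem hasDisjointCycles_iff_adjMatrix_pow_le_one :
    HasDisjointCycles V ↔ ∀ (a : V) (k : ℕ), (adjMatrix V ^ k) a a ≤ 1 := by
  simp only [hasDisjointCycles_iff_closedPath_eq, adjMatrix_pow_apply,
    Finite.card_le_one_iff_subsingleton]
  refine forall_congr' fun a => ⟨fun h k => ⟨fun p q => ?_⟩, fun h p q hpq => ?_⟩
  · exact Subtype.ext (h _ _ (p.2.trans q.2.symm))
  · exact congrArg Subtype.val ((h q.length).elim ⟨p, hpq⟩ ⟨q, rfl⟩)

end Counting

section Matrix

variable {α k m n : Type*} [Fintype m]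

theorem matrix_mul_apply_pos_iff [NonUnitalNonAssocSemiring α] [PartialOrder α]
    [CanonicallyOrderedAdd α] [NoZeroDivisors α]
    {M : Matrix k m α} {N : Matrix m n α} {a : k} {b : n} :
    0 < (M * N) a b ↔ ∃ c, 0 < M a c ∧ 0 < N c b := by
  rw [Matrix.mul_apply, Finset.sum_pos_iff]
  simp only [Finset.mem_univ, true_and, pos_iff_ne_zero, mul_ne_zero_iff]

theorem apply_mul_apply_le_matrix_mul [NonUnitalNonAssocSemiring α] [PartialOrder α]
    [CanonicallyOrderedAdd α] (M : Matrix k m α) (N : Matrix m n α) (a : k) (c : m) (b : n) :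
    M a c * N c b ≤ (M * N) a b :=
  Finset.single_le_sum (f := fun c => M a c * N c b) (fun _ _ => zero_le) (Finset.mem_univ c)

theorem apply_self_pow_le_matrix_pow [Semiring α] [PartialOrder α] [CanonicallyOrderedAdd α]
    [DecidableEq m] (M : Matrix m m α) (a : m) (k : ℕ) : M a a ^ k ≤ (M ^ k) a a := by
  induction k with
  | zero => simp
  | succ k ih =>
    rw [pow_succ, pow_succ]
    exact (mul_le_mul_left ih _).trans (apply_mul_apply_le_matrix_mul _ _ a a a)

end Matrix

section ShiftEquivalence

variable {α m n : Type*} [Fintype m] [DecidableEq m] [Fintype n] [DecidableEq n]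

/-- The pair `(R, S)` is a shift equivalence of lag `l` from `A` to `B`; lag `0` is allowed. -/
structure IsShiftEquivalence [Semiring α] (A : Matrix m m α) (B : Matrix n n α) (R : Matrix m n α)
    (S : Matrix n m α) (l : ℕ) : Prop where
  pow_left : A ^ l = R * S
  pow_right : B ^ l = S * R
  mul_left : A * R = R * B
  mul_right : S * A = B * S

/-- With the positive entries of `A`, `B`, `R` and `S` regarded as edges on the disjoint union of
the index types, `v` and `w` can be reached from each other. -/
def Linked [Semiring α] [PartialOrder α] (A : Matrix m m α) (B : Matrix n n α) (R : Matrix m n α)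
    (S : Matrix n m α) (v : m) (w : n) : Prop :=
  (∃ i : ℕ, 0 < (A ^ i * R : Matrix m n α) v w) ∧ ∃ j : ℕ, 0 < (B ^ j * S : Matrix n m α) w v

theorem Linked.symm [Semiring α] [PartialOrder α] {A : Matrix m m α} {B : Matrix n n α}
    {R : Matrix m n α} {S : Matrix n m α} {v : m} {w : n} (h : Linked A B R S v w) :
    Linked B A S R w v :=
  And.symm h

namespace IsShiftEquivalence

section Semiring

variable [Semiring α] {A : Matrix m m α} {B : Matrix n n α} {R : Matrix m n α} {S : Matrix n m α}
  {l : ℕ}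

theorem symm (h : IsShiftEquivalence A B R S l) : IsShiftEquivalence B A S R l :=
  ⟨h.pow_right, h.pow_left, h.mul_right.symm, h.mul_left.symm⟩

theorem pow_mul_comm (h : IsShiftEquivalence A B R S l) (k : ℕ) : A ^ k * R = R * B ^ k := by
  induction k with
  | zero => simp
  | succ k ih =>
    rw [pow_succ, Matrix.mul_assoc, h.mul_left, ← Matrix.mul_assoc, ih, Matrix.mul_assoc, pow_succ]

theorem pow_add_eq (h : IsShiftEquivalence A B R S l) (k : ℕ) : A ^ (k + l) = R * (B ^ k * S) := by
  rw [pow_add, h.pow_left, ← Matrix.mul_assoc, h.pow_mul_comm, Matrix.mul_assoc]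

end Semiring

theorem trace_pow_add_eq [CommSemiring α] {A : Matrix m m α} {B : Matrix n n α} {R : Matrix m n α}
    {S : Matrix n m α} {l : ℕ} (h : IsShiftEquivalence A B R S l) (k : ℕ) :
    (A ^ (k + l)).trace = (B ^ (k + l)).trace := by
  rw [h.pow_add_eq, Matrix.trace_mul_comm, Matrix.mul_assoc, ← h.pow_right, ← pow_add]

section Positivity

variable [Semiring α] [PartialOrder α] [CanonicallyOrderedAdd α]
  [NoZeroDivisors α] {A : Matrix m m α} {B : Matrix n n α} {R : Matrix m n α} {S : Matrix n m α}
  {l : ℕ}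

theorem exists_pow_pos_of_linked (h : IsShiftEquivalence A B R S l) {v v' : m} {w w' : n}
    (hvw : Linked A B R S v w) (hvw' : Linked A B R S v' w') :
    ∃ t, ∀ k, 0 < (A ^ k) v v' → 0 < (B ^ (k + t)) w w' := by
  obtain ⟨-, j, hj⟩ := hvw
  obtain ⟨⟨i, hi⟩, -⟩ := hvw'
  refine ⟨i + j + l, fun k hk => ?_⟩
  have hfactor : B ^ (k + (i + j + l)) = B ^ j * S * (A ^ k * (A ^ i * R)) := by
    calc B ^ (k + (i + j + l)) = B ^ (j + (k + i) + l) := by congr 1; omega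
      _ = B ^ j * (S * (A ^ (k + i) * R)) := by rw [add_assoc, pow_add, h.symm.pow_add_eq]
      _ = B ^ j * S * (A ^ k * (A ^ i * R)) := by simp only [pow_add, Matrix.mul_assoc]
  rw [hfactor, matrix_mul_apply_pos_iff]
  exact ⟨v, hj, matrix_mul_apply_pos_iff.2 ⟨v', hk, hi⟩⟩

theorem exists_linked (h : IsShiftEquivalence A B R S l) {v : m} {k : ℕ}
    (hk : 0 < k) (hv : 0 < (A ^ k) v v) : ∃ w, Linked A B R S v w := by
  have hpos : 0 < (A ^ (k * l)) v v :=
    (pos_iff_ne_zero.2 (pow_ne_zero l hv.ne')).trans_le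
      (pow_mul A k l ▸ apply_self_pow_le_matrix_pow _ v l)
  obtain ⟨j, hj⟩ := Nat.exists_eq_add_of_le' (Nat.le_mul_of_pos_left l hk)
  rw [hj, h.pow_add_eq, matrix_mul_apply_pos_iff] at hpos
  obtain ⟨w, hR, hS⟩ := hpos
  exact ⟨w, ⟨0, by simpa using hR⟩, j, hS⟩

end Positivity

theorem pow_apply_self_le_one {A : Matrix m m ℕ} {B : Matrix n n ℕ} {R : Matrix m n ℕ}
    {S : Matrix n m ℕ} {l : ℕ} (h : IsShiftEquivalence A B R S l)
    (hB : ∀ w k, (B ^ k) w w ≤ 1) (v : m) (k : ℕ) : (A ^ k) v v ≤ 1 := by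
  by_contra! hgt
  have hk : 0 < k := Nat.pos_of_ne_zero (by rintro rfl; simp at hgt)
  let t := Fintype.card n + l
  obtain ⟨j, hj⟩ : ∃ j, k * t = j + l :=
    Nat.exists_eq_add_of_le' ((Nat.le_add_left l _).trans (Nat.le_mul_of_pos_left t hk))
  have hlt : t < Fintype.card n := calc
    t < (A ^ k) v v ^ t := Nat.lt_pow_self hgt
    _ ≤ (A ^ (k * t)) v v := pow_mul A k t ▸ apply_self_pow_le_matrix_pow _ v t
    _ ≤ (A ^ (k * t)).trace :=
      Finset.single_le_sum (f := fun v => (A ^ (k * t)) v v) (fun _ _ => zero_le)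
        (Finset.mem_univ v)
    _ = (B ^ (k * t)).trace := by rw [hj, h.trace_pow_add_eq]
    _ ≤ ∑ _ : n, 1 := Finset.sum_le_sum fun w _ => hB w _
    _ = Fintype.card n := by simp
  exact hlt.not_ge (Nat.le_add_right _ l)

end IsShiftEquivalence

end ShiftEquivalence

section CycleCorrespondence

open Quiver

variable {V : Type u} [Quiver.{v} V] [Fintype V] [DecidableEq V] [∀ a b : V, Fintype (a ⟶ b)]
  {W : Type u'} [Quiver.{v'} W] [Fintype W] [DecidableEq W] [∀ a b : W, Fintype (a ⟶ b)]
  {R : Matrix V W ℕ} {S : Matrix W V ℕ} {l : ℕ}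

/-- Two cycles correspond under the pair `(R, S)` if they can be based at linked vertices. -/
def CycleSet.Linked (R : Matrix V W ℕ) (S : Matrix W V ℕ) (c : CycleSet V) (d : CycleSet W) :
    Prop :=
  ∃ (γ : BasedCycle V) (δ : BasedCycle W), γ.toCycleSet = c ∧ δ.toCycleSet = d ∧
    GraphCycles.Linked (adjMatrix V) (adjMatrix W) R S γ.base δ.base

theorem CycleSet.Linked.symm {c : CycleSet V} {d : CycleSet W} (h : c.Linked R S d) :
    d.Linked S R c := by
  obtain ⟨γ, δ, hγ, hδ, hγδ⟩ := h
  exact ⟨δ, γ, hδ, hγ, hγδ.symm⟩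

namespace IsShiftEquivalence

theorem hasDisjointCycles (h : IsShiftEquivalence (adjMatrix V) (adjMatrix W) R S l)
    (hW : HasDisjointCycles W) : HasDisjointCycles V :=
  hasDisjointCycles_iff_adjMatrix_pow_le_one.2 <|
    h.pow_apply_self_le_one (hasDisjointCycles_iff_adjMatrix_pow_le_one.1 hW)

theorem exists_length_eq_add (h : IsShiftEquivalence (adjMatrix V) (adjMatrix W) R S l)
    {a a' : V} {b b' : W} (hab : Linked (adjMatrix V) (adjMatrix W) R S a b)
    (hab' : Linked (adjMatrix V) (adjMatrix W) R S a' b') :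
    ∃ t, ∀ p : Path a a', ∃ q : Path b b', q.length = p.length + t := by
  obtain ⟨t, ht⟩ := h.exists_pow_pos_of_linked hab hab'
  exact ⟨t, fun p => adjMatrix_pow_pos_iff.1 (ht _ (adjMatrix_pow_pos_iff.2 ⟨p, rfl⟩))⟩

theorem exists_linked_cycle (h : IsShiftEquivalence (adjMatrix V) (adjMatrix W) R S l)
    (c : CycleSet V) : ∃ d : CycleSet W, c.Linked R S d := by
  refine Quotient.inductionOn c fun γ => ?_
  have hγ := γ.isCycle.1
  obtain ⟨w, hw⟩ := h.exists_linked hγ (adjMatrix_pow_pos_iff.2 ⟨γ.path, rfl⟩)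
  obtain ⟨t, ht⟩ := h.exists_length_eq_add hw hw
  obtain ⟨p, hp⟩ := ht γ.path
  obtain ⟨q, hq⟩ := exists_isCyclePath (p := p) (by omega)
  exact ⟨_, γ, ⟨w, q, hq⟩, rfl, rfl, hw⟩

theorem le_of_linked (h : IsShiftEquivalence (adjMatrix V) (adjMatrix W) R S l)
    {c c' : CycleSet V} {d d' : CycleSet W} (hcd : c.Linked R S d) (hcd' : c'.Linked R S d')
    (hle : c ≤ c') : d ≤ d' := by
  obtain ⟨γ, δ, rfl, rfl, hγδ⟩ := hcd
  obtain ⟨γ', δ', rfl, rfl, hγδ'⟩ := hcd'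
  obtain ⟨p⟩ := BasedCycle.toCycleSet_le_iff.1 hle
  obtain ⟨t, ht⟩ := h.exists_length_eq_add hγδ' hγδ
  obtain ⟨q, -⟩ := ht p
  exact BasedCycle.toCycleSet_le_iff.2 ⟨q⟩

theorem length_dvd_of_linked (h : IsShiftEquivalence (adjMatrix V) (adjMatrix W) R S l)
    (hW : HasDisjointCycles W) {c : CycleSet V} {d : CycleSet W} (hcd : c.Linked R S d) :
    d.length ∣ c.length := by
  obtain ⟨γ, δ, rfl, rfl, hγδ⟩ := hcd
  change δ.path.length ∣ γ.path.length
  obtain ⟨t, ht⟩ := h.exists_length_eq_add hγδ hγδ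
  obtain ⟨p, hp⟩ := ht Path.nil
  obtain ⟨q, hq⟩ := ht γ.path
  have hp_dvd := hW.length_dvd_of_closedPath δ.isCycle p
  have hq_dvd := hW.length_dvd_of_closedPath δ.isCycle q
  rw [hp, Path.length_nil, zero_add] at hp_dvd
  rwa [hq, Nat.dvd_add_left hp_dvd] at hq_dvd

theorem exists_orderIso (h : IsShiftEquivalence (adjMatrix V) (adjMatrix W) R S l)
    (hV : HasDisjointCycles V) (hW : HasDisjointCycles W) :
    ∃ φ : CycleSet V ≃o CycleSet W, ∀ c, (φ c).length = c.length := by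
  let _ := hV.partialOrder
  let _ := hW.partialOrder
  obtain ⟨φ, hφ⟩ : ∃ φ : CycleSet V ≃o CycleSet W,
      ∀ c : CycleSet V, c.Linked R S (φ c) :=
    exists_orderIso_of_rel h.exists_linked_cycle
      (fun d => (h.symm.exists_linked_cycle d).imp fun _ hd => hd.symm)
      (fun hcd hcd' => ⟨h.le_of_linked hcd hcd', h.symm.le_of_linked hcd.symm hcd'.symm⟩)
  exact ⟨φ, fun c => Nat.dvd_antisymm (h.length_dvd_of_linked hW (hφ c))
    (h.symm.length_dvd_of_linked hV (hφ c).symm)⟩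

end IsShiftEquivalence

end CycleCorrespondence

end GraphCycles

theorem theorem3p2_general
    {V : Type*} [Quiver V] [Fintype V] [DecidableEq V] [∀ a b : V, Fintype (a ⟶ b)]
    {W : Type*} [Quiver W] [Fintype W] [DecidableEq W] [∀ a b : W, Fintype (a ⟶ b)]
    (h : GraphCycles.ShiftEquivalent (GraphCycles.adjMatrix V) (GraphCycles.adjMatrix W)) :
    (GraphCycles.HasDisjointCycles V ↔ GraphCycles.HasDisjointCycles W) ∧
      (GraphCycles.HasDisjointCycles V →
        ∃ φ : GraphCycles.CycleSet V ≃o GraphCycles.CycleSet W,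
          ∀ c : GraphCycles.CycleSet V, (φ c).length = c.length) := by
  obtain ⟨l, -, R, S, hA, hB, hR, hS⟩ := h
  have hRS : GraphCycles.IsShiftEquivalence _ _ R S l := ⟨hA, hB, hR, hS⟩
  exact ⟨⟨hRS.symm.hasDisjointCycles, hRS.hasDisjointCycles⟩,
    fun hV => hRS.exists_orderIso hV (hRS.symm.hasDisjointCycles hV)⟩

theorem theorem3p2
    {V : Type*} [Quiver V] [Fintype V] [DecidableEq V] [∀ a b : V, Fintype (a ⟶ b)]
    {W : Type*} [Quiver W] [Fintype W] [DecidableEq W] [∀ a b : W, Fintype (a ⟶ b)]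
    (hV : GraphCycles.IsEssential V) (hW : GraphCycles.IsEssential W)
    (h : GraphCycles.ShiftEquivalent (GraphCycles.adjMatrix V) (GraphCycles.adjMatrix W)) :
    (GraphCycles.HasDisjointCycles V ↔ GraphCycles.HasDisjointCycles W) ∧
      (GraphCycles.HasDisjointCycles V →
        ∃ φ : GraphCycles.CycleSet V ≃o GraphCycles.CycleSet W,
          ∀ c : GraphCycles.CycleSet V, (φ c).length = c.length) := by
  exact theorem3p2_general h
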